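/- Fix an integer $b\ge 2$. For a real number $\alpha\ge 1$, the type III base $b$ continued logarithm of $\alpha$ is defined by the recursion \[ y_0=\alpha,\qquad a_n=\lfloor \log_b y_n\rfloor,\qquad c_n=\left\lfloor \frac{y_n}{b^{a_n}}\right\rfloor,\qquad y_{n+1}=\frac{b^{a_n}}{y_n-c_nb^{a_n}}\qquad(n\ge 0), \] which terminates at index $n$ if $y_n=c_nb^{a_n}$; its terms are the numbers $c_nb^{a_n}$. **Theorem.** For (Lebesgue) almost every $\alpha\in(1,2)$, the type III base $b$ continued logarithm of $\alpha$ does not terminate, and \[ \lim_{N\to\infty}\left(\prod_{n=1}^{N} c_nb^{a_n}\right)^{1/N}=b^{\mathcal A_b}, \qquad\text{where}\qquad \mathcal A_b=\frac{1}{\log b\,\log\frac{b+1}{2b}}\sum_{\ell=2}^{b}\log\left(1-\frac1\ell\right)\log\left(1+\frac1\ell\right). \] -/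

import Mathlib

namespace ContinuedLogarithm

/-- For a positive real `y`, the exponent `a = ⌊log_b y⌋`. -/
noncomputable def exponentOf (b : ℕ) (y : ℝ) : ℤ := ⌊Real.logb (b : ℝ) y⌋

/-- For a positive real `y` with `a = ⌊log_b y⌋`, the coefficient `c = ⌊y / b ^ a⌋`. -/
noncomputable def coeffOf (b : ℕ) (y : ℝ) : ℤ := ⌊y / (b : ℝ) ^ exponentOf b y⌋

/-- The remainders `y_0 = α`, `y_{n+1} = b ^ a_n / (y_n - c_n * b ^ a_n)` of the type III base `b`
continued logarithm of `α`. (If the process has terminated at index `n`, that is, if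
`y_n = c_n * b ^ a_n`, then the values at larger indices carry no meaning.) -/
noncomputable def remainder (b : ℕ) (α : ℝ) : ℕ → ℝ
  | 0 => α
  | n + 1 =>
      (b : ℝ) ^ exponentOf b (remainder b α n) /
        (remainder b α n -
          (coeffOf b (remainder b α n) : ℝ) * (b : ℝ) ^ exponentOf b (remainder b α n))

/-- The exponent `a_n` in the type III base `b` continued logarithm of `α`. -/
noncomputable def exponent (b : ℕ) (α : ℝ) (n : ℕ) : ℤ := exponentOf b (remainder b α n)

/-- The coefficient `c_n` in the type III base `b` continued logarithm of `α`. -/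
noncomputable def coeff (b : ℕ) (α : ℝ) (n : ℕ) : ℤ := coeffOf b (remainder b α n)

/-- The term `c_n * b ^ a_n` of the type III base `b` continued logarithm of `α`. -/
noncomputable def term (b : ℕ) (α : ℝ) (n : ℕ) : ℝ :=
  (coeff b α n : ℝ) * (b : ℝ) ^ exponent b α n

/-- The process that produces the type III base `b` continued logarithm of `α` never terminates:
there is no index `n` with `y_n = c_n * b ^ a_n`. -/
def IsInfinite (b : ℕ) (α : ℝ) : Prop := ∀ n : ℕ, remainder b α n ≠ term b α n

/-- The constant
`𝒜_b = (1 / (log b * log ((b + 1) / (2 b)))) * ∑_{ℓ = 2}^{b} log (1 - 1/ℓ) * log (1 + 1/ℓ)`. -/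
noncomputable def khinchineExponent (b : ℕ) : ℝ :=
  1 / (Real.log (b : ℝ) * Real.log (((b : ℝ) + 1) / (2 * (b : ℝ)))) *
    ∑ l ∈ Finset.Icc 2 b, Real.log (1 - 1 / (l : ℝ)) * Real.log (1 + 1 / (l : ℝ))

end ContinuedLogarithm

/-!
Write `x_n = y_n⁻¹` for the reciprocals of the remainders. Then `x_{n+1} = step b x_n`, where
`step b x` is the fractional part of `x⁻¹ / b ^ a` with `a = ⌊log_b x⁻¹⌋`, a map of the unit
interval similar to the Gauss map. For `α ∈ (1, 2)` one has `a_0 = 0` and `c_0 = 1`, hence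
`x_1 = α - 1`, and the terms with `1 ≤ n ≤ N` are read off from the first `N` points of the orbit of
`α - 1`. The logarithm of their product is therefore a Birkhoff sum, and the theorem is the pointwise
ergodic theorem for `step b`.

* *Invariant measure.* The inverse branches of `step b` are `t ↦ (b ^ a * (c + t))⁻¹` with `0 ≤ a`
  and `1 ≤ c < b`. The density proportional to `1 / (x + 1) - 1 / (x + b)`, pulled back along a
  branch, telescopes first in `a` and then in `c` (`tsum_branchDeriv_mul_density`), so it is
  invariant (`measurePreserving_step`). As the measure is equivalent to Lebesgue measure, almost no
  orbit ever reaches `0`, that is, almost no expansion terminates.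
* *Ergodicity.* Compositions of branches are Möbius transformations with uniformly bounded
  distortion whose images shrink to points (`exists_mobius_inverse`). An invariant set `A` of positive
  measure thus fills a definite proportion of small intervals around almost every point, and by the
  Lebesgue density theorem its complement is null (`ergodic_step`).
* *Pointwise ergodic theorem.* If `g` has negative mean, then its Birkhoff sums are almost everywhere
  bounded above (`ae_bddAbove_maxSum`); applied to `± (f - ∫ f) - ε` this gives convergence of the
  time averages of `f` (`ae_tendsto_birkhoffSum_div`).
* *The constant.* The mean of `log (c * b ^ a)` is the sum of `log c` and `a * log b` weighted by the
  masses of the branches; two summations by parts evaluate it (`integral_logTerm`).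
-/

open MeasureTheory Filter Set Topology

namespace ContinuedLogarithm

/-! ### The pointwise ergodic theorem for ergodic maps -/

/-- `maxSum T g n x` is the largest of the Birkhoff sums `birkhoffSum T g k x` with `k ≤ n`
(the empty sum included), written through the recursion that the maximal ergodic argument uses. -/
noncomputable def maxSum {X : Type*} (T : X → X) (g : X → ℝ) : ℕ → X → ℝ
  | 0, _ => 0
  | n + 1, x => max 0 (g x + maxSum T g n (T x))

section Birkhoff

variable {X : Type*} {T : X → X} {g : X → ℝ}

theorem maxSum_nonneg (n : ℕ) (x : X) : 0 ≤ maxSum T g n x := by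
  cases n with
  | zero => exact le_rfl
  | succ n => exact le_max_left _ _

theorem maxSum_le_succ (n : ℕ) (x : X) : maxSum T g n x ≤ maxSum T g (n + 1) x := by
  induction n generalizing x with
  | zero => exact maxSum_nonneg 1 x
  | succ n ih => exact max_le_max le_rfl (by gcongr; exact ih _)

theorem maxSum_mono (x : X) : Monotone fun n => maxSum T g n x :=
  monotone_nat_of_le_succ fun n => maxSum_le_succ n x

theorem birkhoffSum_le_maxSum (n : ℕ) (x : X) : birkhoffSum T g n x ≤ maxSum T g n x := by
  induction n generalizing x with
  | zero => simp [maxSum]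
  | succ n ih =>
    rw [birkhoffSum_succ']
    exact le_max_of_le_right (by gcongr; exact ih _)

variable [MeasurableSpace X] {μ : Measure X}

theorem measurable_maxSum (hT : Measurable T) (hg : Measurable g) (n : ℕ) :
    Measurable (maxSum T g n) := by
  induction n with
  | zero => exact measurable_const
  | succ n ih => exact measurable_const.max (hg.add (ih.comp hT))

theorem integrable_maxSum (hT : MeasurePreserving T μ μ) (hg : Integrable g μ) (n : ℕ) :
    Integrable (maxSum T g n) μ := by
  induction n with
  | zero => exact integrable_zero _ _ _
  | succ n ih => exact (integrable_zero _ _ _).sup (hg.add (hT.integrable_comp_of_integrable ih))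

/-- If `g` has negative mean then almost every orbit has bounded maximal sums. Otherwise, by
ergodicity, `maxSum T g n` tends to infinity almost everywhere, and then
`0 ≤ ∫ (maxSum T g (n + 1) - maxSum T g n ∘ T) = ∫ max (-maxSum T g n ∘ T) g → ∫ g < 0`. -/
theorem ae_bddAbove_maxSum (hT : Ergodic T μ) (hgm : Measurable g) (hg : Integrable g μ)
    (hneg : ∫ x, g x ∂μ < 0) : ∀ᵐ x ∂μ, ∃ K : ℝ, ∀ n, maxSum T g n x ≤ K := by
  -- Natural bounds make the measurability of `A` a matter of countable unions.
  set A : Set X := {x | ∃ K : ℕ, ∀ n, maxSum T g n x ≤ K} with hA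
  have hAm : MeasurableSet A := by
    have : A = ⋃ K : ℕ, ⋂ n : ℕ, {x | maxSum T g n x ≤ K} := by
      ext x; simp [hA]
    rw [this]
    exact MeasurableSet.iUnion fun K => MeasurableSet.iInter fun n =>
      measurableSet_le (measurable_maxSum hT.measurable hgm n) measurable_const
  have hinv : T ⁻¹' A = A := by
    ext x
    simp only [hA, mem_preimage, mem_ofPred_eq]
    constructor
    · rintro ⟨K, hK⟩
      obtain ⟨K', hK'⟩ := exists_nat_ge (max 0 (g x + K))
      refine ⟨K', fun n => (maxSum_le_succ n x).trans (le_trans ?_ hK')⟩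
      exact max_le_max le_rfl (by gcongr; exact hK n)
    · rintro ⟨K, hK⟩
      obtain ⟨K', hK'⟩ := exists_nat_ge ((K : ℝ) - g x)
      refine ⟨K', fun n => ?_⟩
      have h1 := (le_max_right 0 (g x + maxSum T g n (T x))).trans (hK (n + 1))
      linarith
  rcases hT.toPreErgodic.ae_mem_or_ae_notMem hAm hinv with h | h
  · filter_upwards [h] with x hx
    obtain ⟨K, hK⟩ := hx
    exact ⟨K, hK⟩
  · exfalso
    have hint : ∀ n, 0 ≤ ∫ x, max (-maxSum T g n (T x)) (g x) ∂μ := by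
      intro n
      have hcomp := hT.toMeasurePreserving.integrable_comp_of_integrable
        (integrable_maxSum hT.toMeasurePreserving hg n)
      have e : ∀ x, max (-maxSum T g n (T x)) (g x) =
          maxSum T g (n + 1) x - (maxSum T g n ∘ T) x := by
        intro x
        simp only [maxSum, Function.comp]
        rw [← max_sub_sub_right]
        congr 1 <;> ring
      simp_rw [e]
      rw [integral_sub (integrable_maxSum hT.toMeasurePreserving hg _) hcomp]
      have e2 : ∫ x, (maxSum T g n ∘ T) x ∂μ = ∫ x, maxSum T g n x ∂μ := by
        have := integral_map (μ := μ) (φ := T) hT.measurable.aemeasurable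
          (f := maxSum T g n)
          (measurable_maxSum hT.measurable hgm n).aestronglyMeasurable
        rw [hT.map_eq] at this
        exact this.symm
      rw [e2, ← integral_sub (integrable_maxSum hT.toMeasurePreserving hg _)
        (integrable_maxSum hT.toMeasurePreserving hg _)]
      exact integral_nonneg fun x => sub_nonneg.2 (maxSum_le_succ n x)
    have hlim : Tendsto (fun n => ∫ x, max (-maxSum T g n (T x)) (g x) ∂μ) atTop
        (𝓝 (∫ x, g x ∂μ)) := by
      refine tendsto_integral_of_dominated_convergence (fun x => |g x|) (fun n => ?_) hg.abs
        (fun n => Eventually.of_forall fun x => ?_) ?_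
      · exact (((measurable_maxSum hT.measurable hgm n).comp hT.measurable).neg.max
          hgm).aestronglyMeasurable
      · have h0 := maxSum_nonneg (T := T) (g := g) n (T x)
        rw [Real.norm_eq_abs, abs_le]
        exact ⟨(neg_abs_le _).trans (le_max_right _ _),
          max_le (by linarith [abs_nonneg (g x)]) (le_abs_self _)⟩
      · filter_upwards [h] with x hx
        have hx' : T x ∉ A := fun h' => hx (hinv ▸ h')
        simp only [hA, mem_ofPred_eq, not_exists, not_forall, not_le] at hx'
        obtain ⟨K, hK⟩ := exists_nat_ge (-g x)
        obtain ⟨n, hn⟩ := hx' K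
        refine tendsto_const_nhds.congr' ?_
        filter_upwards [eventually_ge_atTop n] with m hm
        have := maxSum_mono (T := T) (g := g) (T x) hm
        simp only at this
        exact (max_eq_right (by linarith)).symm
    exact absurd (ge_of_tendsto' hlim hint) (not_le.2 hneg)

/-- The upper half of the ergodic theorem: `limsup` of the time averages is at most the mean. -/
theorem ae_eventually_birkhoffSum_lt [IsProbabilityMeasure μ] (hT : Ergodic T μ)
    (hgm : Measurable g) (hg : Integrable g μ) :
    ∀ᵐ x ∂μ, ∀ ε : ℝ, 0 < ε →
      ∀ᶠ n : ℕ in atTop, birkhoffSum T g n x / n < ∫ x, g x ∂μ + ε := by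
  have key : ∀ k : ℕ, ∀ᵐ x ∂μ, ∃ K : ℝ, ∀ n,
      maxSum T (fun x => g x - (∫ x, g x ∂μ + 1 / ((k : ℝ) + 1))) n x ≤ K := by
    intro k
    refine ae_bddAbove_maxSum hT (hgm.sub_const _) (hg.sub (integrable_const _)) ?_
    rw [integral_sub hg (integrable_const _)]
    simp only [integral_const, probReal_univ, one_smul]
    have : 0 < 1 / ((k : ℝ) + 1) := by positivity
    linarith
  filter_upwards [ae_all_iff.2 key] with x hx ε hε
  obtain ⟨k, hk⟩ := exists_nat_one_div_lt (half_pos hε)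
  obtain ⟨K, hK⟩ := hx k
  obtain ⟨N, hN⟩ := exists_nat_gt (K / (ε / 2))
  filter_upwards [eventually_ge_atTop (N + 1)] with n hn
  have hn0 : (0 : ℝ) < n := by exact_mod_cast (show 0 < n by omega)
  have hNn : (N : ℝ) ≤ n := by exact_mod_cast (show N ≤ n by omega)
  have h1 := (birkhoffSum_le_maxSum n x).trans (hK n)
  have h2 : birkhoffSum T (fun x => g x - (∫ x, g x ∂μ + 1 / ((k : ℝ) + 1))) n x =
      birkhoffSum T g n x - n * (∫ x, g x ∂μ + 1 / ((k : ℝ) + 1)) := by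
    simp only [birkhoffSum, Finset.sum_sub_distrib, Finset.sum_const, Finset.card_range,
      nsmul_eq_mul]
  rw [h2] at h1
  rw [div_lt_iff₀ (half_pos hε)] at hN
  rw [div_lt_iff₀ hn0]
  nlinarith

/-- **Pointwise ergodic theorem** for an ergodic map of a probability space. -/
theorem ae_tendsto_birkhoffSum_div [IsProbabilityMeasure μ] (hT : Ergodic T μ)
    (hgm : Measurable g) (hg : Integrable g μ) :
    ∀ᵐ x ∂μ, Tendsto (fun n : ℕ => birkhoffSum T g n x / n) atTop (𝓝 (∫ x, g x ∂μ)) := by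
  filter_upwards [ae_eventually_birkhoffSum_lt hT hgm hg,
    ae_eventually_birkhoffSum_lt hT hgm.neg hg.neg] with x h1 h2
  rw [Metric.tendsto_nhds]
  intro ε hε
  filter_upwards [h1 ε hε, h2 ε hε] with n a1 a2
  have e : birkhoffSum T (-g) n x = -birkhoffSum T g n x := by
    simp [birkhoffSum]
  rw [e, neg_div] at a2
  simp only [Pi.neg_apply, integral_neg] at a2
  rw [Real.dist_eq, abs_lt]
  constructor <;> linarith

end Birkhoff

/-! ### The remainder map and its inverse branches -/

/-- The map induced on reciprocals of remainders: if `x = y_n⁻¹` then `step b x = y_{n+1}⁻¹`. -/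
noncomputable def step (b : ℕ) (x : ℝ) : ℝ := Int.fract (x⁻¹ / (b : ℝ) ^ exponentOf b x⁻¹)

/-- The inverse branch of `step b` on the set of points with exponent `a` and coefficient `c`. -/
noncomputable def branch (b a c : ℕ) (t : ℝ) : ℝ := ((b : ℝ) ^ a * (c + t))⁻¹

/-- The absolute value of the derivative of `branch b a c`. -/
noncomputable def branchDeriv (b a c : ℕ) (t : ℝ) : ℝ := ((b : ℝ) ^ a * (c + t) ^ 2)⁻¹

section Branches

variable {b a c : ℕ} {t : ℝ}

theorem exponentOf_inv_branch (hc : 1 ≤ c) (hcb : c < b) (ht : t ∈ Ico (0 : ℝ) 1) :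
    exponentOf b (branch b a c t)⁻¹ = a := by
  have hb1 : (1 : ℝ) < b := by exact_mod_cast (show 1 < b by omega)
  have hc' : (1 : ℝ) ≤ c := by exact_mod_cast hc
  have hcb' : (c : ℝ) + 1 ≤ b := by exact_mod_cast hcb
  have hpow : (0 : ℝ) < (b : ℝ) ^ a := by positivity
  have ht0 := ht.1
  have ht1 := ht.2
  have hy : (0 : ℝ) < (b : ℝ) ^ a * (c + t) := by positivity
  rw [exponentOf, branch, inv_inv, Int.floor_eq_iff]
  constructor
  · rw [Real.le_logb_iff_rpow_le hb1 hy]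
    simp only [Int.cast_natCast, Real.rpow_natCast]
    nlinarith
  · rw [Real.logb_lt_iff_lt_rpow hb1 hy]
    have : ((a : ℤ) : ℝ) + 1 = ((a + 1 : ℕ) : ℝ) := by push_cast; ring
    rw [this, Real.rpow_natCast, pow_succ]
    gcongr
    linarith

theorem inv_branch_div (hc : 1 ≤ c) (hcb : c < b) (ht : t ∈ Ico (0 : ℝ) 1) :
    (branch b a c t)⁻¹ / (b : ℝ) ^ exponentOf b (branch b a c t)⁻¹ = c + t := by
  have hb0 : (b : ℝ) ≠ 0 := by exact_mod_cast (show b ≠ 0 by omega)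
  rw [exponentOf_inv_branch hc hcb ht, branch, inv_inv, zpow_natCast]
  field_simp

theorem coeffOf_inv_branch (hc : 1 ≤ c) (hcb : c < b) (ht : t ∈ Ico (0 : ℝ) 1) :
    coeffOf b (branch b a c t)⁻¹ = c := by
  rw [coeffOf, inv_branch_div hc hcb ht, Int.floor_natCast_add, Int.floor_eq_zero_iff.2 ht,
    add_zero]

theorem step_branch (hc : 1 ≤ c) (hcb : c < b) (ht : t ∈ Ico (0 : ℝ) 1) :
    step b (branch b a c t) = t := by
  rw [step, inv_branch_div hc hcb ht, Int.fract_natCast_add, Int.fract_eq_self.2 ht]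

theorem branch_mem_Ioo (hc : 1 ≤ c) (hcb : c < b) (ht : t ∈ Ioo (0 : ℝ) 1) :
    branch b a c t ∈ Ioo (0 : ℝ) 1 := by
  have hb1 : (1 : ℝ) ≤ b := by exact_mod_cast (show 1 ≤ b by omega)
  have hc' : (1 : ℝ) ≤ c := by exact_mod_cast hc
  have hpow : (1 : ℝ) ≤ (b : ℝ) ^ a := one_le_pow₀ hb1
  have ht0 := ht.1
  have h : 1 < (b : ℝ) ^ a * (c + t) := by nlinarith
  exact ⟨inv_pos.2 (by linarith), inv_lt_one_of_one_lt₀ h⟩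

theorem step_mem_Ico (b : ℕ) (x : ℝ) : step b x ∈ Ico (0 : ℝ) 1 :=
  ⟨Int.fract_nonneg _, Int.fract_lt_one _⟩

theorem exists_eq_branch_step (hb : 2 ≤ b) {x : ℝ} (hx : x ∈ Ioo (0 : ℝ) 1) :
    ∃ a c : ℕ, 1 ≤ c ∧ c < b ∧ x = branch b a c (step b x) := by
  have hb1 : (1 : ℝ) < b := by exact_mod_cast (show 1 < b by omega)
  have hy : 1 < x⁻¹ := (one_lt_inv₀ hx.1).2 hx.2
  have hy0 : 0 < x⁻¹ := by linarith
  have hlog : 0 ≤ Real.logb b x⁻¹ := Real.logb_nonneg hb1 hy.le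
  obtain ⟨a, ha⟩ := Int.eq_ofNat_of_zero_le (Int.floor_nonneg.2 hlog)
  have hfl := Int.floor_eq_iff.1 ha
  rw [Real.le_logb_iff_rpow_le hb1 hy0, Real.logb_lt_iff_lt_rpow hb1 hy0] at hfl
  have : ((a : ℤ) : ℝ) + 1 = ((a + 1 : ℕ) : ℝ) := by push_cast; ring
  rw [this, Real.rpow_natCast, pow_succ, Int.cast_natCast, Real.rpow_natCast] at hfl
  have hpow : (0 : ℝ) < (b : ℝ) ^ a := by positivity
  have hq1 : 1 ≤ x⁻¹ / (b : ℝ) ^ a := (one_le_div hpow).2 hfl.1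
  have hqb : x⁻¹ / (b : ℝ) ^ a < b := by rw [div_lt_iff₀ hpow]; linarith [hfl.2]
  have hst : step b x = Int.fract (x⁻¹ / (b : ℝ) ^ a) := by
    rw [step, exponentOf, ha, zpow_natCast]
  obtain ⟨c, hc⟩ := Int.eq_ofNat_of_zero_le (Int.floor_nonneg.2 (zero_le_one.trans hq1))
  refine ⟨a, c, ?_, ?_, ?_⟩
  · have : (1 : ℤ) ≤ ⌊x⁻¹ / (b : ℝ) ^ a⌋ := Int.le_floor.2 (by simpa using hq1)
    rw [hc] at this
    exact_mod_cast this
  · have : ⌊x⁻¹ / (b : ℝ) ^ a⌋ < (b : ℤ) := Int.floor_lt.2 (by simpa using hqb)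
    rw [hc] at this
    exact_mod_cast this
  · rw [hst, Int.fract, hc, branch]
    push_cast
    rw [add_sub_cancel, mul_div_cancel₀ _ hpow.ne', inv_inv]

theorem hasDerivAt_branch (hb : b ≠ 0) (hs : (c : ℝ) + t ≠ 0) :
    HasDerivAt (branch b a c) (-branchDeriv b a c t) t := by
  have hb0 : (b : ℝ) ≠ 0 := by exact_mod_cast hb
  have hpow : (b : ℝ) ^ a ≠ 0 := pow_ne_zero _ hb0
  have h := (((hasDerivAt_id t).const_add (c : ℝ)).const_mul ((b : ℝ) ^ a)).inv
    (mul_ne_zero hpow hs)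
  refine h.congr_deriv ?_
  rw [branchDeriv]
  simp only [id]
  field_simp

theorem branchDeriv_nonneg (b a c : ℕ) (t : ℝ) : 0 ≤ branchDeriv b a c t := by
  unfold branchDeriv; positivity

theorem measurable_exponentOf (b : ℕ) : Measurable (exponentOf b) :=
  (Real.measurable_log.div_const _).floor

theorem measurable_zpow_exponentOf (b : ℕ) :
    Measurable fun x : ℝ => (b : ℝ) ^ exponentOf b x :=
  (Measurable.of_discrete (f := fun n : ℤ => (b : ℝ) ^ n)).comp (measurable_exponentOf b)

theorem measurable_step (b : ℕ) : Measurable (step b) :=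
  (measurable_inv.div ((measurable_zpow_exponentOf b).comp measurable_inv)).fract

end Branches

/-- Up to a countable set, the unit interval is the disjoint union of the images of the inverse
branches, so that integrals over it split into integrals over the branches. -/
theorem setLIntegral_Ioo_eq_tsum_branch {b : ℕ} (hb : 2 ≤ b) (f : ℝ → ENNReal) :
    ∫⁻ x in Ioo (0 : ℝ) 1, f x = ∑' p : ℕ × Fin (b - 1), ∫⁻ t in Ioo (0 : ℝ) 1,
      ENNReal.ofReal (branchDeriv b p.1 (p.2 + 1) t) * f (branch b p.1 (p.2 + 1) t) := by
  have hcb : ∀ p : ℕ × Fin (b - 1), 1 ≤ (p.2 : ℕ) + 1 ∧ (p.2 : ℕ) + 1 < b := fun p =>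
    ⟨by omega, by have := p.2.2; omega⟩
  have hIco : ∀ t ∈ Ioo (0 : ℝ) 1, t ∈ Ico (0 : ℝ) 1 := fun t ht => Ioo_subset_Ico_self ht
  have hne : ∀ p : ℕ × Fin (b - 1), ∀ t ∈ Ioo (0 : ℝ) 1,
      (((p.2 : ℕ) + 1 : ℕ) : ℝ) + t ≠ 0 := fun p t ht => by
    have := ht.1
    positivity
  have hinj : ∀ p : ℕ × Fin (b - 1), InjOn (branch b p.1 (p.2 + 1)) (Ioo (0 : ℝ) 1) := by
    intro p t ht t' ht' h
    rw [← step_branch (a := p.1) (hcb p).1 (hcb p).2 (hIco t ht), h,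
      step_branch (hcb p).1 (hcb p).2 (hIco t' ht')]
  have hderiv : ∀ p : ℕ × Fin (b - 1), ∀ t ∈ Ioo (0 : ℝ) 1,
      HasDerivWithinAt (branch b p.1 (p.2 + 1)) (-branchDeriv b p.1 (p.2 + 1) t)
        (Ioo (0 : ℝ) 1) t := fun p t ht =>
    (hasDerivAt_branch (by omega) (hne p t ht)).hasDerivWithinAt
  have hmeas : ∀ p : ℕ × Fin (b - 1),
      MeasurableSet (branch b p.1 (p.2 + 1) '' Ioo (0 : ℝ) 1) := fun p =>
    measurableSet_Ioo.image_of_continuousOn_injOn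
      (fun t ht => (hderiv p t ht).continuousWithinAt) (hinj p)
  have hdisj : Pairwise (Function.onFun Disjoint fun p : ℕ × Fin (b - 1) =>
      branch b p.1 (p.2 + 1) '' Ioo (0 : ℝ) 1) := by
    intro p q hpq
    refine Set.disjoint_left.2 ?_
    rintro _ ⟨t, ht, rfl⟩ ⟨t', ht', h⟩
    refine hpq ?_
    have h1 := exponentOf_inv_branch (a := q.1) (hcb q).1 (hcb q).2 (hIco t' ht')
    have h2 := coeffOf_inv_branch (a := q.1) (hcb q).1 (hcb q).2 (hIco t' ht')
    rw [h, exponentOf_inv_branch (hcb p).1 (hcb p).2 (hIco t ht)] at h1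
    rw [h, coeffOf_inv_branch (hcb p).1 (hcb p).2 (hIco t ht)] at h2
    refine Prod.ext (by exact_mod_cast h1) (Fin.ext ?_)
    have : (p.2 : ℕ) + 1 = (q.2 : ℕ) + 1 := by exact_mod_cast h2
    omega
  have hunion : Ioo (0 : ℝ) 1 =ᵐ[volume]
      ⋃ p : ℕ × Fin (b - 1), branch b p.1 (p.2 + 1) '' Ioo (0 : ℝ) 1 := by
    have hcount : (range fun p : ℕ × Fin (b - 1) => branch b p.1 (p.2 + 1) 0).Countable :=
      countable_range _
    filter_upwards [hcount.ae_notMem volume] with x hx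
    refine propext ⟨fun h => ?_, fun h => ?_⟩
    · obtain ⟨a, c, hc1, hc2, hxe⟩ := exists_eq_branch_step hb h
      have hs := step_mem_Ico b x
      have hs0 : step b x ≠ 0 := by
        intro h0
        rw [h0] at hxe
        refine hx ⟨(a, ⟨c - 1, by omega⟩), ?_⟩
        simp only [Nat.sub_add_cancel hc1]
        exact hxe.symm
      refine mem_iUnion.2 ⟨(a, ⟨c - 1, by omega⟩), step b x,
        ⟨lt_of_le_of_ne hs.1 hs0.symm, hs.2⟩, ?_⟩
      simp only [Nat.sub_add_cancel hc1]
      exact hxe.symm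
    · obtain ⟨p, t, ht, rfl⟩ := mem_iUnion.1 h
      exact branch_mem_Ioo (hcb p).1 (hcb p).2 ht
  rw [setLIntegral_congr hunion, lintegral_iUnion hmeas hdisj]
  refine tsum_congr fun p => ?_
  rw [lintegral_image_eq_lintegral_abs_deriv_mul measurableSet_Ioo (hderiv p) (hinj p)]
  simp only [abs_neg, abs_of_nonneg (branchDeriv_nonneg _ _ _ _)]

/-! ### The invariant measure -/

/-- The total mass `log (2b / (b + 1))` of the density `1 / (x + 1) - 1 / (x + b)` on the unit
interval. -/
noncomputable def totalMass (b : ℕ) : ℝ := Real.log (2 * b / (b + 1))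

/-- The density of the invariant probability measure of `step b` on the unit interval. -/
noncomputable def density (b : ℕ) (x : ℝ) : ℝ := (totalMass b)⁻¹ * (1 / (x + 1) - 1 / (x + b))

/-- The invariant probability measure of `step b`, supported on the unit interval. -/
noncomputable def invMeasure (b : ℕ) : Measure ℝ :=
  (volume.restrict (Ioo (0 : ℝ) 1)).withDensity fun x => ENNReal.ofReal (density b x)

theorem totalMass_pos {b : ℕ} (hb : 2 ≤ b) : 0 < totalMass b := by
  have hb' : (2 : ℝ) ≤ b := by exact_mod_cast hb
  refine Real.log_pos ?_
  rw [lt_div_iff₀ (by linarith)]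
  linarith

theorem measurable_density (b : ℕ) : Measurable (density b) := by
  unfold density; fun_prop

theorem density_pos {b : ℕ} (hb : 2 ≤ b) {x : ℝ} (hx : 0 < x) : 0 < density b x := by
  have hb' : (2 : ℝ) ≤ b := by exact_mod_cast hb
  have := totalMass_pos hb
  have h : 1 / (x + b) < 1 / (x + 1) := one_div_lt_one_div_of_lt (by linarith) (by linarith)
  exact mul_pos (inv_pos.2 this) (sub_pos.2 h)

/-- The density carried by one branch is a difference of consecutive terms in the exponent `a`,
which is what makes `density` a fixed point of the transfer operator. -/
theorem branchDeriv_mul_density {b : ℕ} (hb : 2 ≤ b) (a : ℕ) {c : ℕ} (hc : 1 ≤ c) {t : ℝ}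
    (ht : 0 < t) :
    branchDeriv b a c t * density b (branch b a c t) = (totalMass b)⁻¹ *
      (1 / (t + (c + ((b : ℝ) ^ (a + 1))⁻¹)) - 1 / (t + (c + ((b : ℝ) ^ a)⁻¹))) := by
  have hb' : (2 : ℝ) ≤ b := by exact_mod_cast hb
  have hc' : (1 : ℝ) ≤ c := by exact_mod_cast hc
  have hB : (0 : ℝ) < (b : ℝ) ^ a := by positivity
  rw [branchDeriv, density, branch, pow_succ (b : ℝ) a]
  generalize (b : ℝ) ^ a = B at hB ⊢
  field_simp
  ring

theorem tsum_ofReal_sub_of_tendsto {F : ℕ → ℝ} (hF : Monotone F) {l : ℝ}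
    (hl : Tendsto F atTop (𝓝 l)) :
    ∑' n, ENNReal.ofReal (F (n + 1) - F n) = ENNReal.ofReal (l - F 0) := by
  have hnn : ∀ n, 0 ≤ F (n + 1) - F n := fun n => sub_nonneg.2 (hF n.le_succ)
  have hs : HasSum (fun n => F (n + 1) - F n) (l - F 0) := by
    rw [hasSum_iff_tendsto_nat_of_nonneg hnn]
    simp only [Finset.sum_range_sub]
    exact hl.sub_const _
  rw [← hs.tsum_eq, ENNReal.ofReal_tsum_of_nonneg hnn hs.summable]

theorem tendsto_inv_pow_atTop {b : ℕ} (hb : 2 ≤ b) :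
    Tendsto (fun a : ℕ => ((b : ℝ) ^ a)⁻¹) atTop (𝓝 0) :=
  tendsto_inv_atTop_zero.comp
    (tendsto_pow_atTop_atTop_of_one_lt (by exact_mod_cast (show 1 < b by omega)))

theorem antitone_inv_pow {b : ℕ} (hb : 2 ≤ b) : Antitone fun a : ℕ => ((b : ℝ) ^ a)⁻¹ := by
  have hb1 : (1 : ℝ) ≤ b := by exact_mod_cast (show 1 ≤ b by omega)
  intro m n h
  have : (0 : ℝ) < (b : ℝ) ^ m := by positivity
  exact inv_anti₀ this (pow_le_pow_right₀ hb1 h)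

/-- `density b` is fixed by the transfer operator of `step b`. -/
theorem tsum_branchDeriv_mul_density {b : ℕ} (hb : 2 ≤ b) {t : ℝ} (ht : 0 < t) :
    ∑' p : ℕ × Fin (b - 1), ENNReal.ofReal (branchDeriv b p.1 (p.2 + 1) t) *
      ENNReal.ofReal (density b (branch b p.1 (p.2 + 1) t)) = ENNReal.ofReal (density b t) := by
  have hZ : 0 ≤ (totalMass b)⁻¹ := inv_nonneg.2 (totalMass_pos hb).le
  have h1 : ∀ p : ℕ × Fin (b - 1), ENNReal.ofReal (branchDeriv b p.1 (p.2 + 1) t) *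
      ENNReal.ofReal (density b (branch b p.1 (p.2 + 1) t)) = ENNReal.ofReal
        ((totalMass b)⁻¹ * (1 / (t + (((p.2 : ℕ) + 1 : ℕ) + ((b : ℝ) ^ (p.1 + 1))⁻¹))) -
          (totalMass b)⁻¹ * (1 / (t + (((p.2 : ℕ) + 1 : ℕ) + ((b : ℝ) ^ p.1)⁻¹)))) := by
    intro p
    rw [← ENNReal.ofReal_mul (branchDeriv_nonneg _ _ _ _),
      branchDeriv_mul_density hb _ (by omega) ht, mul_sub]
  simp_rw [h1]
  rw [ENNReal.tsum_prod (f := fun (a : ℕ) (i : Fin (b - 1)) => ENNReal.ofReal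
        ((totalMass b)⁻¹ * (1 / (t + (((i : ℕ) + 1 : ℕ) + ((b : ℝ) ^ (a + 1))⁻¹))) -
          (totalMass b)⁻¹ * (1 / (t + (((i : ℕ) + 1 : ℕ) + ((b : ℝ) ^ a)⁻¹))))),
    ENNReal.tsum_comm, tsum_fintype]
  have h2 : ∀ i : Fin (b - 1), ∑' a : ℕ, ENNReal.ofReal
        ((totalMass b)⁻¹ * (1 / (t + (((i : ℕ) + 1 : ℕ) + ((b : ℝ) ^ (a + 1))⁻¹))) -
          (totalMass b)⁻¹ * (1 / (t + (((i : ℕ) + 1 : ℕ) + ((b : ℝ) ^ a)⁻¹)))) =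
      ENNReal.ofReal ((totalMass b)⁻¹ * (1 / (t + ((i : ℕ) + 1)) -
        1 / (t + (((i + 1 : ℕ) : ℝ) + 1)))) := by
    intro i
    rw [tsum_ofReal_sub_of_tendsto (F := fun a => (totalMass b)⁻¹ *
      (1 / (t + (((i : ℕ) + 1 : ℕ) + ((b : ℝ) ^ a)⁻¹))))
      (l := (totalMass b)⁻¹ * (1 / (t + (((i : ℕ) + 1 : ℕ) + 0))))]
    · congr 1
      push_cast
      ring_nf
    · intro m n h
      have := antitone_inv_pow hb h
      simp only at this ⊢
      gcongr
    · refine (tendsto_const_nhds.div (tendsto_const_nhds.add (tendsto_const_nhds.add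
        (tendsto_inv_pow_atTop hb))) ?_).const_mul _
      positivity
  simp_rw [h2]
  rw [← ENNReal.ofReal_sum_of_nonneg, ← Finset.mul_sum,
    Fin.sum_univ_eq_sum_range (fun i : ℕ => 1 / (t + ((i : ℝ) + 1)) -
        1 / (t + (((i + 1 : ℕ) : ℝ) + 1))) (b - 1),
    Finset.sum_range_sub' (fun i : ℕ => 1 / (t + ((i : ℝ) + 1)))]
  · rw [density]
    have : ((b - 1 : ℕ) : ℝ) = b - 1 := by rw [Nat.cast_sub (by omega)]; simp
    rw [this]
    simp
  · intro i _
    refine mul_nonneg hZ (sub_nonneg.2 ?_)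
    gcongr
    omega

theorem measurable_branch (b a c : ℕ) : Measurable (branch b a c) := by
  unfold branch; fun_prop

theorem measurable_branchDeriv (b a c : ℕ) : Measurable (branchDeriv b a c) := by
  unfold branchDeriv; fun_prop

theorem lintegral_invMeasure (b : ℕ) (f : ℝ → ENNReal) (hf : Measurable f) :
    ∫⁻ x, f x ∂invMeasure b = ∫⁻ x in Ioo (0 : ℝ) 1, ENNReal.ofReal (density b x) * f x := by
  rw [invMeasure, lintegral_withDensity_eq_lintegral_mul _
    (measurable_density b).ennreal_ofReal hf]
  rfl

theorem measurePreserving_step {b : ℕ} (hb : 2 ≤ b) :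
    MeasurePreserving (step b) (invMeasure b) (invMeasure b) := by
  refine ⟨measurable_step b, Measure.ext fun E hE => ?_⟩
  rw [Measure.map_apply (measurable_step b) hE, ← lintegral_indicator_one hE,
    ← lintegral_indicator_one (measurable_step b hE),
    lintegral_invMeasure _ _ (measurable_one.indicator hE),
    lintegral_invMeasure _ _ (measurable_one.indicator (measurable_step b hE)),
    setLIntegral_Ioo_eq_tsum_branch hb, ← lintegral_tsum]
  · refine setLIntegral_congr_fun measurableSet_Ioo fun t ht => ?_
    rw [← tsum_branchDeriv_mul_density hb ht.1, ← ENNReal.tsum_mul_right]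
    refine tsum_congr fun p => ?_
    have h : (step b ⁻¹' E).indicator (1 : ℝ → ENNReal) (branch b p.1 (p.2 + 1) t) =
        E.indicator 1 t := by
      have hp := p.2.2
      have hs := step_branch (b := b) (a := p.1) (c := p.2 + 1) (by omega) (by omega)
        (Ioo_subset_Ico_self ht)
      by_cases hE' : t ∈ E
      · rw [indicator_of_mem hE', indicator_of_mem (by rwa [mem_preimage, hs])]
        rfl
      · rw [indicator_of_notMem hE', indicator_of_notMem (by rwa [mem_preimage, hs])]
    rw [h, mul_assoc]
  · intro p
    exact ((measurable_branchDeriv _ _ _).ennreal_ofReal.mul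
      (((measurable_density b).ennreal_ofReal.mul
        (measurable_one.indicator (measurable_step b hE))).comp
          (measurable_branch _ _ _))).aemeasurable

theorem setLIntegral_Ioo_sub_inv {K p q : ℝ} (hK : 0 ≤ K) (hp : 0 < p) (hpq : p ≤ q) :
    ∫⁻ t in Ioo (0 : ℝ) 1, ENNReal.ofReal (K * (1 / (t + p) - 1 / (t + q))) =
      ENNReal.ofReal (K * (Real.log ((p + 1) / p) - Real.log ((q + 1) / q))) := by
  have hd : ∀ t ∈ uIcc (0 : ℝ) 1, HasDerivAt
      (fun t => K * (Real.log (t + p) - Real.log (t + q)))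
      (K * (1 / (t + p) - 1 / (t + q))) t := by
    intro t ht
    rw [uIcc_of_le zero_le_one] at ht
    have h1 : t + p ≠ 0 := by linarith [ht.1]
    have h2 : t + q ≠ 0 := by linarith [ht.1]
    exact ((((hasDerivAt_id t).add_const p).log h1).sub
      (((hasDerivAt_id t).add_const q).log h2)).const_mul K
  have hc : ContinuousOn (fun t : ℝ => K * (1 / (t + p) - 1 / (t + q))) (Icc 0 1) := by
    refine continuousOn_const.mul (ContinuousOn.sub ?_ ?_) <;>
    · refine continuousOn_const.div (by fun_prop) fun t ht => ?_
      linarith [ht.1]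
  have hint : IntervalIntegrable (fun t : ℝ => K * (1 / (t + p) - 1 / (t + q))) volume 0 1 := by
    apply ContinuousOn.intervalIntegrable
    rwa [uIcc_of_le zero_le_one]
  have hI := intervalIntegral.integral_eq_sub_of_hasDerivAt hd hint
  rw [intervalIntegral.integral_of_le zero_le_one, integral_Ioc_eq_integral_Ioo] at hI
  rw [← ofReal_integral_eq_lintegral_ofReal, hI]
  · congr 1
    rw [Real.log_div (by linarith) hp.ne', Real.log_div (by linarith) (by linarith)]
    ring_nf
  · exact (intervalIntegrable_iff_integrableOn_Ioo_of_le zero_le_one).1 hint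
  · filter_upwards [ae_restrict_mem measurableSet_Ioo] with t ht
    have ht0 := ht.1
    refine mul_nonneg hK (sub_nonneg.2 ?_)
    gcongr

theorem isProbabilityMeasure_invMeasure {b : ℕ} (hb : 2 ≤ b) :
    IsProbabilityMeasure (invMeasure b) := by
  have hb' : (2 : ℝ) ≤ b := by exact_mod_cast hb
  have hZ := totalMass_pos hb
  refine ⟨?_⟩
  rw [invMeasure, withDensity_apply _ MeasurableSet.univ, Measure.restrict_univ]
  simp only [density]
  rw [setLIntegral_Ioo_sub_inv (inv_nonneg.2 hZ.le) one_pos (by linarith),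
    ← Real.log_div (by norm_num) (by positivity)]
  have : ((1 : ℝ) + 1) / 1 / ((b + 1) / b) = 2 * b / (b + 1) := by field_simp; norm_num
  rw [this, ← totalMass, inv_mul_cancel₀ hZ.ne', ENNReal.ofReal_one]

/-! ### Ergodicity -/

theorem invMeasure_absolutelyContinuous (b : ℕ) :
    invMeasure b ≪ volume.restrict (Ioo (0 : ℝ) 1) :=
  withDensity_absolutelyContinuous _ _

theorem absolutelyContinuous_invMeasure {b : ℕ} (hb : 2 ≤ b) :
    volume.restrict (Ioo (0 : ℝ) 1) ≪ invMeasure b := by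
  refine withDensity_absolutelyContinuous' (measurable_density b).ennreal_ofReal.aemeasurable ?_
  filter_upwards [ae_restrict_mem measurableSet_Ioo] with x hx
  exact (ENNReal.ofReal_pos.2 (density_pos hb hx.1)).ne'

/-- Almost every orbit stays in the open unit interval: the expansion does not terminate. -/
theorem ae_forall_iterate_step_mem {b : ℕ} (hb : 2 ≤ b) :
    ∀ᵐ x ∂volume.restrict (Ioo (0 : ℝ) 1), ∀ n, (step b)^[n] x ∈ Ioo (0 : ℝ) 1 := by
  refine ae_all_iff.2 fun n => (absolutelyContinuous_invMeasure hb).ae_le ?_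
  have h : ∀ᵐ x ∂invMeasure b, x ∈ Ioo (0 : ℝ) 1 :=
    (invMeasure_absolutelyContinuous b).ae_le (ae_restrict_mem measurableSet_Ioo)
  exact ((measurePreserving_step hb).iterate n).quasiMeasurePreserving.ae h

/-- A cylinder of rank `n` is the image of the unit interval under a Möbius transformation
`t ↦ (p * t + q) / (r * t + s)` inverting `(step b)^[n]`. The relation `0 ≤ r ≤ s` bounds its
distortion, and the last inequality says that the length of the cylinder, which is
`|p * s - q * r| / (s * (r + s))`, is at most `2⁻ⁿ`. -/
theorem exists_mobius_inverse {b : ℕ} (hb : 2 ≤ b) {x : ℝ} (n : ℕ)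
    (hx : ∀ k ≤ n, (step b)^[k] x ∈ Ioo (0 : ℝ) 1) :
    ∃ p q r s : ℝ, p * s - q * r ≠ 0 ∧ 0 ≤ r ∧ r ≤ s ∧ 0 < s ∧
      2 ^ n * |p * s - q * r| ≤ s * (r + s) ∧
      (p * (step b)^[n] x + q) / (r * (step b)^[n] x + s) = x ∧
      ∀ t ∈ Ioo (0 : ℝ) 1, (step b)^[n] ((p * t + q) / (r * t + s)) = t := by
  induction n with
  | zero => exact ⟨1, 0, 0, 1, by norm_num, by norm_num, by norm_num, by norm_num, by norm_num,
      by simp, by simp⟩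
  | succ n ih =>
    obtain ⟨p, q, r, s, hD, hr, hrs, hs, hlen, hxe, hinv⟩ := ih fun k hk => hx k (by omega)
    obtain ⟨a, c, hc1, hcb, hy⟩ := exists_eq_branch_step hb (hx n (by omega))
    have hb' : (1 : ℝ) ≤ b := by exact_mod_cast (show 1 ≤ b by omega)
    have hc' : (1 : ℝ) ≤ c := by exact_mod_cast hc1
    have hB : (1 : ℝ) ≤ (b : ℝ) ^ a := one_le_pow₀ hb'
    have hcomp : ∀ t ∈ Ioo (0 : ℝ) 1,
        (q * (b : ℝ) ^ a * t + (p + q * (b : ℝ) ^ a * c)) /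
          (s * (b : ℝ) ^ a * t + (r + s * (b : ℝ) ^ a * c)) =
        (p * branch b a c t + q) / (r * branch b a c t + s) := by
      intro t ht
      have ht0 := ht.1
      have h1 : 0 < s * (b : ℝ) ^ a * t + (r + s * (b : ℝ) ^ a * c) := by positivity
      have h2 : 0 < r * branch b a c t + s := by unfold branch; positivity
      have h3 : 0 < (b : ℝ) ^ a * (c + t) := by positivity
      have h4 : branch b a c t * ((b : ℝ) ^ a * (c + t)) = 1 := inv_mul_cancel₀ h3.ne'
      rw [div_eq_div_iff h1.ne' h2.ne']
      linear_combination (r * q - p * s) * h4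
    have hdet : q * (b : ℝ) ^ a * (r + s * (b : ℝ) ^ a * c) -
        (p + q * (b : ℝ) ^ a * c) * (s * (b : ℝ) ^ a) = -(b : ℝ) ^ a * (p * s - q * r) := by
      ring
    have hsB : s ≤ s * (b : ℝ) ^ a := le_mul_of_one_le_right hs.le hB
    have hsBc : s * (b : ℝ) ^ a ≤ s * (b : ℝ) ^ a * c :=
      le_mul_of_one_le_right (by positivity) hc'
    -- The new coefficients are those of the composition with `branch b a c`, scaled by `b ^ a`.
    refine ⟨q * (b : ℝ) ^ a, p + q * (b : ℝ) ^ a * c, s * (b : ℝ) ^ a, r + s * (b : ℝ) ^ a * c,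
      ?_, by positivity, by linarith, by positivity, ?_, ?_, ?_⟩
    · rw [hdet]
      exact mul_ne_zero (neg_ne_zero.2 (by positivity)) hD
    · rw [hdet, abs_mul, abs_neg, abs_of_pos (by positivity : 0 < (b : ℝ) ^ a), pow_succ]
      generalize (b : ℝ) ^ a = B at *
      calc 2 ^ n * 2 * (B * |p * s - q * r|) = 2 * B * (2 ^ n * |p * s - q * r|) := by ring
        _ ≤ 2 * B * (s * (r + s)) := by gcongr
        _ ≤ (r + s * B) * (s * B + (r + s * B)) := by
          nlinarith [mul_nonneg (mul_nonneg hr hs.le) (zero_le_one.trans hB),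
            mul_nonneg (mul_nonneg hs.le hs.le) (mul_nonneg (zero_le_one.trans hB)
              (sub_nonneg.2 hB)), mul_nonneg hr hr]
        _ ≤ (r + s * B * c) * (s * B + (r + s * B * c)) := by gcongr
    · have ht := hx (n + 1) le_rfl
      rw [Function.iterate_succ_apply'] at ht ⊢
      rw [hcomp _ ht, ← hy, hxe]
    · intro t ht
      rw [hcomp t ht, Function.iterate_succ_apply', hinv _ (branch_mem_Ioo hc1 hcb ht),
        step_branch hc1 hcb (Ioo_subset_Ico_self ht)]

/-- Bounded distortion: an invariant set occupies a definite proportion of arbitrarily small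
intervals around every point with a non-terminating expansion. -/
theorem exists_le_volume_inter_closedBall {b : ℕ} (hb : 2 ≤ b) {A : Set ℝ}
    (hA : MeasurableSet A) (hinv : step b ⁻¹' A = A) {x : ℝ}
    (hx : ∀ k, (step b)^[k] x ∈ Ioo (0 : ℝ) 1) (n : ℕ) :
    ∃ δ : ℝ, 0 < δ ∧ δ ≤ 2 * (1 / 2) ^ n ∧
      ENNReal.ofReal (δ / 4) * volume (A ∩ Ioo 0 1) ≤ volume (A ∩ Metric.closedBall x δ) := by
  obtain ⟨p, q, r, s, hD, hr, hrs, hs, hlen, hxe, hstep⟩ :=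
    exists_mobius_inverse hb n fun k _ => hx k
  have hDpos : 0 < |p * s - q * r| := abs_pos.2 hD
  set D := |p * s - q * r| with hDdef
  set φ : ℝ → ℝ := fun t => (p * t + q) / (r * t + s) with hφ
  have hy := hx n
  set y := (step b)^[n] x
  have hden : ∀ t ∈ Ioo (0 : ℝ) 1, s ≤ r * t + s ∧ r * t + s ≤ 2 * s := fun t ht => by
    constructor <;> nlinarith [ht.1, ht.2]
  have hderiv : ∀ t ∈ A ∩ Ioo (0 : ℝ) 1, HasDerivWithinAt φ
      ((p * s - q * r) / (r * t + s) ^ 2) (A ∩ Ioo (0 : ℝ) 1) t := by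
    intro t ht
    have h0 : r * t + s ≠ 0 := (hs.trans_le (hden t ht.2).1).ne'
    have h := (((hasDerivAt_id t).const_mul p).add_const q).div
      (((hasDerivAt_id t).const_mul r).add_const s) h0
    refine (h.congr_deriv ?_).hasDerivWithinAt
    simp only [id]
    congr 1
    ring
  have hinj : InjOn φ (A ∩ Ioo (0 : ℝ) 1) := by
    intro t ht t' ht' h
    rw [← hstep t ht.2, ← hstep t' ht'.2]
    exact congrArg _ h
  -- `D / s ^ 2` bounds the derivative of `φ`, hence the length of the cylinder; on the other hand
  -- the derivative is at least `D / (2 * s) ^ 2` because `r ≤ s`.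
  refine ⟨D / s ^ 2, by positivity, ?_, ?_⟩
  · have h2 : (0 : ℝ) < 2 ^ n := by positivity
    rw [one_div, inv_pow, ← div_eq_mul_inv, div_le_div_iff₀ (by positivity) h2]
    nlinarith
  · have hsub : φ '' (A ∩ Ioo (0 : ℝ) 1) ⊆ A ∩ Metric.closedBall x (D / s ^ 2) := by
      rintro _ ⟨t, ⟨htA, ht⟩, rfl⟩
      constructor
      · have hit : (step b)^[n] ⁻¹' A = A :=
          (congrFun Set.preimage_iterate_eq A).trans (Function.IsFixedPt.iterate hinv n)
        rw [← hit, mem_preimage, hstep t ht]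
        exact htA
      · have h1 := (hden t ht).1
        have h2 := (hden y hy).1
        have hd : φ t - x = (p * s - q * r) * (t - y) / ((r * t + s) * (r * y + s)) := by
          have e1 : r * t + s ≠ 0 := (hs.trans_le h1).ne'
          have e2 : r * y + s ≠ 0 := (hs.trans_le h2).ne'
          rw [← hxe, hφ, div_sub_div _ _ e1 e2]
          congr 1
          ring
        rw [Metric.mem_closedBall, Real.dist_eq, hd, abs_div, abs_mul, ← hDdef,
          abs_of_pos (mul_pos (hs.trans_le h1) (hs.trans_le h2))]
        have hty : |t - y| ≤ 1 := abs_le.2 ⟨by linarith [ht.1, hy.2], by linarith [ht.2, hy.1]⟩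
        refine div_le_div₀ hDpos.le (mul_le_of_le_one_right hDpos.le hty) (by positivity) ?_
        rw [sq]
        exact mul_le_mul h1 h2 hs.le (hs.le.trans h1)
    refine le_trans ?_ (measure_mono hsub)
    rw [← setLIntegral_one (φ '' (A ∩ Ioo (0 : ℝ) 1)),
      lintegral_image_eq_lintegral_abs_deriv_mul (hA.inter measurableSet_Ioo) hderiv hinj,
      ← setLIntegral_const]
    refine setLIntegral_mono' (hA.inter measurableSet_Ioo) fun t ht => ?_
    have h1 := hden t ht.2
    rw [mul_one, abs_div, ← hDdef, abs_of_nonneg (sq_nonneg (r * t + s)), div_div]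
    refine ENNReal.ofReal_le_ofReal (div_le_div_of_nonneg_left hDpos.le ?_ ?_)
    · have := hs.trans_le h1.1
      positivity
    · nlinarith [h1.1, h1.2]

/-- An invariant set of positive measure has full measure, because by bounded distortion its
complement has no density points. -/
theorem volume_compl_inter_eq_zero {b : ℕ} (hb : 2 ≤ b) {A : Set ℝ}
    (hA : MeasurableSet A) (hinv : step b ⁻¹' A = A) (hpos : volume (A ∩ Ioo 0 1) ≠ 0) :
    volume (Aᶜ ∩ Ioo 0 1) = 0 := by
  set S := Aᶜ ∩ Ioo (0 : ℝ) 1 with hS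
  rw [← Measure.restrict_eq_zero, ← ae_eq_bot, ← Filter.eventually_false_iff_eq_bot]
  have hgen : ∀ᵐ x ∂volume.restrict S, ∀ n, (step b)^[n] x ∈ Ioo (0 : ℝ) 1 :=
    ae_restrict_of_ae_restrict_of_subset inter_subset_right (ae_forall_iterate_step_mem hb)
  filter_upwards [IsUnifLocDoublingMeasure.ae_tendsto_measure_inter_div volume S 1, hgen]
    with x hdens hx
  choose δ hδ0 hδ1 hδ using exists_le_volume_inter_closedBall hb hA hinv hx
  have hδlim : Tendsto δ atTop (𝓝[>] 0) := by
    refine tendsto_nhdsWithin_iff.2 ⟨?_, Eventually.of_forall hδ0⟩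
    refine squeeze_zero (fun n => (hδ0 n).le) hδ1 ?_
    have := (tendsto_pow_atTop_nhds_zero_of_lt_one (r := (1 / 2 : ℝ)) (by norm_num)
      (by norm_num)).const_mul 2
    rwa [mul_zero] at this
  have hlim := hdens (fun _ => x) δ hδlim (Eventually.of_forall fun n =>
    Metric.mem_closedBall_self (by linarith [hδ0 n]))
  have hfin : volume (A ∩ Ioo (0 : ℝ) 1) ≠ ⊤ :=
    measure_ne_top_of_subset inter_subset_right (by simp)
  set m := (volume (A ∩ Ioo (0 : ℝ) 1)).toReal with hm
  have hm0 : 0 < m := ENNReal.toReal_pos hpos hfin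
  -- `A` takes up `m * δ n / 4` of a ball of volume `2 * δ n`, so `S` misses the proportion `m / 8`.
  have hbound : ∀ n, volume (S ∩ Metric.closedBall x (δ n)) / volume (Metric.closedBall x (δ n)) +
      ENNReal.ofReal (m / 8) ≤ 1 := by
    intro n
    have h1 : volume (S ∩ Metric.closedBall x (δ n)) + ENNReal.ofReal (δ n / 4 * m) ≤
        volume (Metric.closedBall x (δ n)) := by
      rw [ENNReal.ofReal_mul (by linarith [hδ0 n]), hm, ENNReal.ofReal_toReal hfin]
      refine (add_le_add le_rfl (hδ n)).trans ?_
      rw [← measure_inter_add_sdiff (Metric.closedBall x (δ n)) hA, add_comm, inter_comm A]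
      gcongr
      exact fun z hz => ⟨hz.2, hz.1.1⟩
    have hV : volume (Metric.closedBall x (δ n)) = ENNReal.ofReal (2 * δ n) :=
      Real.volume_closedBall x (δ n)
    have h2 : ENNReal.ofReal (m / 8) =
        ENNReal.ofReal (δ n / 4 * m) / volume (Metric.closedBall x (δ n)) := by
      rw [hV, ← ENNReal.ofReal_div_of_pos (by linarith [hδ0 n])]
      congr 1
      have := (hδ0 n).ne'
      field_simp
      norm_num
    rw [h2, ← ENNReal.add_div]
    exact (ENNReal.div_le_div_right h1 _).trans ENNReal.div_self_le_one
  have hle := le_of_tendsto' (hlim.add_const (ENNReal.ofReal (m / 8))) hbound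
  have : ENNReal.ofReal (m / 8) = 0 := by
    have h3 : (1 : ENNReal) + ENNReal.ofReal (m / 8) ≤ 1 + 0 := by simpa using hle
    exact nonpos_iff_eq_zero.1 ((ENNReal.add_le_add_iff_left ENNReal.one_ne_top).1 h3)
  rw [ENNReal.ofReal_eq_zero] at this
  linarith

theorem ergodic_step {b : ℕ} (hb : 2 ≤ b) : Ergodic (step b) (invMeasure b) := by
  refine ⟨measurePreserving_step hb, ⟨fun A hA hinv => ?_⟩⟩
  rw [eventuallyConst_set]
  by_cases h : volume (A ∩ Ioo (0 : ℝ) 1) = 0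
  · right
    refine (invMeasure_absolutelyContinuous b).ae_le ?_
    rw [← Measure.restrict_apply hA] at h
    exact measure_eq_zero_iff_ae_notMem.1 h
  · left
    refine (invMeasure_absolutelyContinuous b).ae_le ?_
    have h' := volume_compl_inter_eq_zero hb hA hinv h
    rw [← Measure.restrict_apply hA.compl] at h'
    exact h'

/-! ### The mean of the logarithm of a term -/

/-- The logarithm of the term `c * b ^ a` of the remainder `x⁻¹`. -/
noncomputable def logTerm (b : ℕ) (x : ℝ) : ℝ :=
  Real.log ((coeffOf b x⁻¹ : ℝ) * (b : ℝ) ^ exponentOf b x⁻¹)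

theorem measurable_logTerm (b : ℕ) : Measurable (logTerm b) := by
  have h1 : Measurable fun x : ℝ => ((coeffOf b x : ℤ) : ℝ) :=
    (Measurable.of_discrete (f := fun n : ℤ => (n : ℝ))).comp
      (measurable_id.div (measurable_zpow_exponentOf b)).floor
  exact Real.measurable_log.comp ((h1.comp measurable_inv).mul
    ((measurable_zpow_exponentOf b).comp measurable_inv))

theorem logTerm_branch {b a c : ℕ} (hc : 1 ≤ c) (hcb : c < b) {t : ℝ} (ht : t ∈ Ico (0 : ℝ) 1) :
    logTerm b (branch b a c t) = Real.log c + a * Real.log b := by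
  have hb0 : (b : ℝ) ≠ 0 := by exact_mod_cast (show b ≠ 0 by omega)
  have hc0 : (c : ℝ) ≠ 0 := by exact_mod_cast (show c ≠ 0 by omega)
  rw [logTerm, coeffOf_inv_branch hc hcb ht, exponentOf_inv_branch hc hcb ht, Int.cast_natCast,
    zpow_natCast, Real.log_mul hc0 (pow_ne_zero _ hb0), Real.log_pow]

theorem logTerm_nonneg {b : ℕ} (hb : 2 ≤ b) {x : ℝ} (hx : x ∈ Ioo (0 : ℝ) 1) :
    0 ≤ logTerm b x := by
  obtain ⟨a, c, hc, hcb, h⟩ := exists_eq_branch_step hb hx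
  rw [h, logTerm_branch hc hcb (step_mem_Ico b x)]
  exact add_nonneg (Real.log_natCast_nonneg c)
    (mul_nonneg (Nat.cast_nonneg a) (Real.log_natCast_nonneg b))

/-- For `p > 0`, the integral of `1 / (t + p)` over the unit interval. -/
noncomputable def logRatio (p : ℝ) : ℝ := Real.log ((p + 1) / p)

theorem logRatio_eq_sub {p : ℝ} (hp : 0 < p) :
    logRatio p = Real.log (p + 1) - Real.log p := by
  rw [logRatio, Real.log_div (by linarith) hp.ne']

theorem logRatio_eq_log_one_add {p : ℝ} (hp : 0 < p) : logRatio p = Real.log (1 + 1 / p) := by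
  rw [logRatio, add_div, div_self hp.ne']

theorem logRatio_anti {p q : ℝ} (hp : 0 < p) (hpq : p ≤ q) : logRatio q ≤ logRatio p := by
  rw [logRatio_eq_log_one_add hp, logRatio_eq_log_one_add (hp.trans_le hpq)]
  have : 0 < 1 / q := one_div_pos.2 (hp.trans_le hpq)
  gcongr

theorem tendsto_logRatio {ι : Type*} {l : Filter ι} {f : ι → ℝ} {p : ℝ} (hp : 0 < p)
    (hf : Tendsto f l (𝓝 p)) : Tendsto (fun i => logRatio (f i)) l (𝓝 (logRatio p)) :=
  ((hf.add_const 1).div hf hp.ne').log (div_pos (by linarith) hp).ne'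

/-- For `1 ≤ c < b`, the invariant measure of the set of points with exponent `a` and
coefficient `c`. -/
noncomputable def branchMass (b a c : ℕ) : ℝ := (totalMass b)⁻¹ *
  (logRatio (c + ((b : ℝ) ^ (a + 1))⁻¹) - logRatio (c + ((b : ℝ) ^ a)⁻¹))

theorem branchMass_nonneg {b : ℕ} (hb : 2 ≤ b) (a : ℕ) {c : ℕ} (hc : 1 ≤ c) :
    0 ≤ branchMass b a c := by
  have hc' : (1 : ℝ) ≤ c := by exact_mod_cast hc
  refine mul_nonneg (inv_nonneg.2 (totalMass_pos hb).le) (sub_nonneg.2 (logRatio_anti ?_ ?_))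
  · positivity
  · have := antitone_inv_pow hb a.le_succ
    simp only [Nat.succ_eq_add_one] at this
    gcongr

theorem lintegral_logTerm_eq_tsum {b : ℕ} (hb : 2 ≤ b) :
    ∫⁻ x, ENNReal.ofReal (logTerm b x) ∂invMeasure b = ∑' p : ℕ × Fin (b - 1),
      ENNReal.ofReal (Real.log ((p.2 : ℕ) + 1 : ℕ) + p.1 * Real.log b) *
        ENNReal.ofReal (branchMass b p.1 (p.2 + 1)) := by
  rw [lintegral_invMeasure _ _ (measurable_logTerm b).ennreal_ofReal,
    setLIntegral_Ioo_eq_tsum_branch hb]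
  refine tsum_congr fun p => ?_
  have hp := p.2.2
  have hc' : (1 : ℝ) ≤ ((p.2 : ℕ) + 1 : ℕ) := by exact_mod_cast Nat.le_add_left 1 _
  have h1 : ∀ t ∈ Ioo (0 : ℝ) 1, ENNReal.ofReal (branchDeriv b p.1 (p.2 + 1) t) *
      (ENNReal.ofReal (density b (branch b p.1 (p.2 + 1) t)) *
        ENNReal.ofReal (logTerm b (branch b p.1 (p.2 + 1) t))) =
      ENNReal.ofReal (Real.log ((p.2 : ℕ) + 1 : ℕ) + p.1 * Real.log b) *
        ENNReal.ofReal ((totalMass b)⁻¹ *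
      (1 / (t + (((p.2 : ℕ) + 1 : ℕ) + ((b : ℝ) ^ (p.1 + 1))⁻¹)) -
        1 / (t + (((p.2 : ℕ) + 1 : ℕ) + ((b : ℝ) ^ p.1)⁻¹)))) := by
    intro t ht
    rw [logTerm_branch (by omega) (by omega) (Ioo_subset_Ico_self ht), ← mul_assoc,
      ← ENNReal.ofReal_mul (branchDeriv_nonneg _ _ _ _),
      branchDeriv_mul_density hb _ (by omega) ht.1, mul_comm]
  rw [setLIntegral_congr_fun measurableSet_Ioo h1, lintegral_const_mul' _ _ ENNReal.ofReal_ne_top,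
    setLIntegral_Ioo_sub_inv (inv_nonneg.2 (totalMass_pos hb).le)]
  · rfl
  · positivity
  · have := antitone_inv_pow hb p.1.le_succ
    simp only [Nat.succ_eq_add_one] at this
    gcongr

theorem tsum_branchMass {b : ℕ} (hb : 2 ≤ b) {c : ℕ} (hc : 1 ≤ c) :
    ∑' a, ENNReal.ofReal (branchMass b a c) =
      ENNReal.ofReal ((totalMass b)⁻¹ * (logRatio c - logRatio (c + 1))) := by
  have hc' : (1 : ℝ) ≤ c := by exact_mod_cast hc
  have h := tsum_ofReal_sub_of_tendsto
    (F := fun a => (totalMass b)⁻¹ * logRatio (c + ((b : ℝ) ^ a)⁻¹))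
    (l := (totalMass b)⁻¹ * logRatio c) ?_ ?_
  · simp only [← mul_sub, pow_zero, inv_one] at h
    exact h
  · refine monotone_nat_of_le_succ fun a => ?_
    have := branchMass_nonneg hb a hc
    rw [branchMass, mul_sub] at this
    linarith
  · have h0 := tendsto_logRatio (p := c) (by linarith)
      (by simpa using (tendsto_inv_pow_atTop hb).const_add (c : ℝ))
    exact h0.const_mul _

/-- The sequence whose second differences give the distribution of the exponent. -/
noncomputable def logOneAddInvPow (b a : ℕ) : ℝ := Real.log (1 + ((b : ℝ) ^ a)⁻¹)

theorem sum_logRatio {u : ℝ} (hu : 0 < u) (n : ℕ) :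
    ∑ i ∈ Finset.range n, logRatio ((i + 1 : ℕ) + u) =
      Real.log (n + 1 + u) - Real.log (1 + u) := by
  have h : ∀ i ∈ Finset.range n, logRatio ((i + 1 : ℕ) + u) =
      Real.log ((i + 1 : ℕ) + 1 + u) - Real.log (i + 1 + u) := by
    intro i _
    rw [logRatio_eq_sub (by positivity)]
    push_cast
    ring_nf
  rw [Finset.sum_congr rfl h, Finset.sum_range_sub (fun i : ℕ => Real.log ((i : ℝ) + 1 + u))]
  simp

theorem sum_branchMass {b : ℕ} (hb : 2 ≤ b) (a : ℕ) :
    ∑ i ∈ Finset.range (b - 1), branchMass b a (i + 1) = (totalMass b)⁻¹ *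
      (logOneAddInvPow b (a + 2) - 2 * logOneAddInvPow b (a + 1) + logOneAddInvPow b a) := by
  have hb' : (2 : ℝ) ≤ b := by exact_mod_cast hb
  have hcast : ((b - 1 : ℕ) : ℝ) + 1 = b := by
    rw [Nat.cast_sub (by omega)]; simp
  have hlog : ∀ k : ℕ, Real.log (b + ((b : ℝ) ^ k)⁻¹) =
      Real.log b + logOneAddInvPow b (k + 1) := by
    intro k
    rw [logOneAddInvPow, ← Real.log_mul (by positivity) (by positivity)]
    congr 1
    rw [pow_succ]
    field_simp
  simp only [branchMass]
  rw [← Finset.mul_sum, Finset.sum_sub_distrib, sum_logRatio (by positivity),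
    sum_logRatio (by positivity), hcast, hlog, hlog]
  simp only [logOneAddInvPow]
  ring_nf

theorem tendsto_mul_logOneAddInvPow {b : ℕ} (hb : 2 ≤ b) :
    Tendsto (fun n : ℕ => (n : ℝ) * logOneAddInvPow b n) atTop (𝓝 0) := by
  have hb' : (2 : ℝ) ≤ b := by exact_mod_cast hb
  have h := tendsto_self_mul_const_pow_of_lt_one (r := (b : ℝ)⁻¹) (by positivity)
    (inv_lt_one_of_one_lt₀ (by linarith))
  refine squeeze_zero (fun n => ?_) (fun n => ?_) h
  · refine mul_nonneg (Nat.cast_nonneg n) (Real.log_nonneg ?_)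
    have : 0 < ((b : ℝ) ^ n)⁻¹ := by positivity
    linarith
  · rw [inv_pow]
    refine mul_le_mul_of_nonneg_left ?_ (Nat.cast_nonneg n)
    have : 0 < ((b : ℝ) ^ n)⁻¹ := by positivity
    have := Real.log_le_sub_one_of_pos (x := 1 + ((b : ℝ) ^ n)⁻¹) (by linarith)
    rw [logOneAddInvPow]
    linarith

theorem tendsto_logOneAddInvPow {b : ℕ} (hb : 2 ≤ b) :
    Tendsto (logOneAddInvPow b) atTop (𝓝 0) := by
  have h := ((tendsto_inv_pow_atTop hb).const_add 1).log (by norm_num)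
  rw [add_zero, Real.log_one] at h
  exact h

/-- Summation by parts for the mean of the exponent. -/
theorem hasSum_mul_sum_branchMass {b : ℕ} (hb : 2 ≤ b) :
    HasSum (fun a : ℕ => (a : ℝ) * Real.log b *
      ∑ i ∈ Finset.range (b - 1), branchMass b a (i + 1))
      ((totalMass b)⁻¹ * (Real.log b * Real.log (1 + 1 / b))) := by
  rw [hasSum_iff_tendsto_nat_of_nonneg fun a => mul_nonneg
    (mul_nonneg (Nat.cast_nonneg a) (Real.log_natCast_nonneg b))
    (Finset.sum_nonneg fun i _ => branchMass_nonneg hb a (by omega))]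
  have hpart : ∀ n : ℕ, ∑ a ∈ Finset.range n, (a : ℝ) * Real.log b *
      ∑ i ∈ Finset.range (b - 1), branchMass b a (i + 1) =
      (totalMass b)⁻¹ * (Real.log b * (((n + 1 : ℕ) : ℝ) * logOneAddInvPow b (n + 1) -
        2 * logOneAddInvPow b (n + 1) - n * logOneAddInvPow b n + logOneAddInvPow b 1)) := by
    intro n
    induction n with
    | zero =>
      simp only [Finset.range_zero, Finset.sum_empty, zero_add, Nat.cast_one, Nat.cast_zero]
      ring
    | succ n ih =>
      rw [Finset.sum_range_succ, ih, sum_branchMass hb]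
      push_cast
      ring
  simp only [hpart]
  have h1 := tendsto_mul_logOneAddInvPow hb
  have h2 := tendsto_logOneAddInvPow hb
  have h3 := ((((((tendsto_add_atTop_iff_nat 1).2 h1).sub
    (((tendsto_add_atTop_iff_nat 1).2 h2).const_mul 2)).sub h1).add_const
      (logOneAddInvPow b 1)).const_mul (Real.log b)).const_mul (totalMass b)⁻¹
  convert h3 using 3
  simp [logOneAddInvPow]

/-- Summation by parts for the mean of the logarithm of the coefficient. -/
theorem sum_log_mul_logRatio (n : ℕ) :
    ∑ i ∈ Finset.range n, Real.log (i + 1 : ℕ) *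
        (logRatio (i + 1 : ℕ) - logRatio ((i + 1 : ℕ) + 1)) +
      Real.log (n + 1 : ℕ) * Real.log (1 + 1 / ((n + 1 : ℕ) : ℝ)) =
    -∑ l ∈ Finset.Icc 2 (n + 1), Real.log (1 - 1 / (l : ℝ)) * Real.log (1 + 1 / (l : ℝ)) := by
  induction n with
  | zero => simp
  | succ n ih =>
    have hlog : Real.log (1 - 1 / ((n + 1 + 1 : ℕ) : ℝ)) =
        Real.log (n + 1 : ℕ) - Real.log (n + 1 + 1 : ℕ) := by
      rw [← Real.log_div (by positivity) (by positivity)]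
      congr 1
      push_cast
      field_simp
      ring
    rw [Finset.sum_range_succ, Finset.sum_Icc_succ_top (by omega), neg_add, ← ih, hlog,
      logRatio_eq_log_one_add (by positivity), logRatio_eq_log_one_add (by positivity)]
    push_cast
    ring

theorem mean_eq_log_mul_khinchineExponent {b : ℕ} (hb : 2 ≤ b) :
    (totalMass b)⁻¹ * ∑ i ∈ Finset.range (b - 1), Real.log (i + 1 : ℕ) *
        (logRatio (i + 1 : ℕ) - logRatio ((i + 1 : ℕ) + 1)) +
      (totalMass b)⁻¹ * (Real.log b * Real.log (1 + 1 / b)) =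
    Real.log b * khinchineExponent b := by
  have hb' : (2 : ℝ) ≤ b := by exact_mod_cast hb
  have h := sum_log_mul_logRatio (b - 1)
  rw [Nat.sub_add_cancel (by omega : 1 ≤ b)] at h
  have hlogb : Real.log b ≠ 0 := (Real.log_pos (by linarith)).ne'
  have hZ := (totalMass_pos hb).ne'
  have hneg : Real.log (((b : ℝ) + 1) / (2 * b)) = -totalMass b := by
    rw [totalMass, ← Real.log_inv, inv_div]
  rw [← mul_add, h, khinchineExponent, hneg]
  field_simp

theorem coeffMean_nonneg {b : ℕ} (hb : 2 ≤ b) :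
    0 ≤ (totalMass b)⁻¹ * ∑ i ∈ Finset.range (b - 1), Real.log (i + 1 : ℕ) *
        (logRatio (i + 1 : ℕ) - logRatio ((i + 1 : ℕ) + 1)) :=
  mul_nonneg (inv_nonneg.2 (totalMass_pos hb).le) (Finset.sum_nonneg fun i _ =>
    mul_nonneg (Real.log_natCast_nonneg _)
      (sub_nonneg.2 (logRatio_anti (by positivity) (by linarith))))

theorem exponentMean_nonneg {b : ℕ} (hb : 2 ≤ b) :
    0 ≤ (totalMass b)⁻¹ * (Real.log b * Real.log (1 + 1 / b)) := by
  refine mul_nonneg (inv_nonneg.2 (totalMass_pos hb).le)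
    (mul_nonneg (Real.log_natCast_nonneg b) (Real.log_nonneg ?_))
  have : 0 ≤ 1 / (b : ℝ) := by positivity
  linarith

theorem lintegral_logTerm {b : ℕ} (hb : 2 ≤ b) :
    ∫⁻ x, ENNReal.ofReal (logTerm b x) ∂invMeasure b =
      ENNReal.ofReal (Real.log b * khinchineExponent b) := by
  have hZ : 0 ≤ (totalMass b)⁻¹ := inv_nonneg.2 (totalMass_pos hb).le
  have hsplit : ∀ p : ℕ × Fin (b - 1),
      ENNReal.ofReal (Real.log ((p.2 : ℕ) + 1 : ℕ) + p.1 * Real.log b) *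
        ENNReal.ofReal (branchMass b p.1 (p.2 + 1)) =
      ENNReal.ofReal (Real.log ((p.2 : ℕ) + 1 : ℕ)) *
        ENNReal.ofReal (branchMass b p.1 (p.2 + 1)) +
      ENNReal.ofReal (p.1 * Real.log b) * ENNReal.ofReal (branchMass b p.1 (p.2 + 1)) := by
    intro p
    rw [ENNReal.ofReal_add (Real.log_natCast_nonneg _)
      (mul_nonneg (Nat.cast_nonneg _) (Real.log_natCast_nonneg b)), add_mul]
  have hcoeff : ∑' p : ℕ × Fin (b - 1), ENNReal.ofReal (Real.log ((p.2 : ℕ) + 1 : ℕ)) *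
        ENNReal.ofReal (branchMass b p.1 (p.2 + 1)) =
      ENNReal.ofReal ((totalMass b)⁻¹ * ∑ i ∈ Finset.range (b - 1), Real.log (i + 1 : ℕ) *
        (logRatio (i + 1 : ℕ) - logRatio ((i + 1 : ℕ) + 1))) := by
    rw [ENNReal.tsum_prod (f := fun (a : ℕ) (i : Fin (b - 1)) =>
        ENNReal.ofReal (Real.log ((i : ℕ) + 1 : ℕ)) * ENNReal.ofReal (branchMass b a (i + 1))),
      ENNReal.tsum_comm, tsum_fintype, Finset.mul_sum, ← Fin.sum_univ_eq_sum_range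
        (fun i : ℕ => (totalMass b)⁻¹ * (Real.log (i + 1 : ℕ) *
          (logRatio (i + 1 : ℕ) - logRatio ((i + 1 : ℕ) + 1)))), ENNReal.ofReal_sum_of_nonneg]
    · refine Finset.sum_congr rfl fun i _ => ?_
      rw [ENNReal.tsum_mul_left, tsum_branchMass hb (by omega),
        ← ENNReal.ofReal_mul (Real.log_natCast_nonneg _)]
      ring_nf
    · intro i _
      refine mul_nonneg hZ (mul_nonneg (Real.log_natCast_nonneg _) (sub_nonneg.2 ?_))
      exact logRatio_anti (by positivity) (by linarith)
  have hexp : ∑' p : ℕ × Fin (b - 1), ENNReal.ofReal (p.1 * Real.log b) *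
        ENNReal.ofReal (branchMass b p.1 (p.2 + 1)) =
      ENNReal.ofReal ((totalMass b)⁻¹ * (Real.log b * Real.log (1 + 1 / b))) := by
    have hs := hasSum_mul_sum_branchMass hb
    rw [ENNReal.tsum_prod (f := fun (a : ℕ) (i : Fin (b - 1)) =>
        ENNReal.ofReal (a * Real.log b) * ENNReal.ofReal (branchMass b a (i + 1))),
      ← hs.tsum_eq, ENNReal.ofReal_tsum_of_nonneg _ hs.summable]
    · refine tsum_congr fun a => ?_
      rw [ENNReal.tsum_mul_left, tsum_fintype, ← ENNReal.ofReal_sum_of_nonneg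
          fun i _ => branchMass_nonneg hb a (by omega),
        Fin.sum_univ_eq_sum_range (fun i : ℕ => branchMass b a (i + 1)),
        ENNReal.ofReal_mul (mul_nonneg (Nat.cast_nonneg _) (Real.log_natCast_nonneg b))]
    · exact fun a => mul_nonneg
        (mul_nonneg (Nat.cast_nonneg a) (Real.log_natCast_nonneg b))
        (Finset.sum_nonneg fun i _ => branchMass_nonneg hb a (by omega))
  rw [lintegral_logTerm_eq_tsum hb]
  simp_rw [hsplit]
  rw [ENNReal.tsum_add, hcoeff, hexp,
    ← ENNReal.ofReal_add (coeffMean_nonneg hb) (exponentMean_nonneg hb),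
    mean_eq_log_mul_khinchineExponent hb]

theorem ae_nonneg_logTerm {b : ℕ} (hb : 2 ≤ b) : 0 ≤ᵐ[invMeasure b] logTerm b := by
  refine (withDensity_absolutelyContinuous _ _).ae_le ?_
  filter_upwards [ae_restrict_mem measurableSet_Ioo] with x hx
  exact logTerm_nonneg hb hx

theorem integrable_logTerm {b : ℕ} (hb : 2 ≤ b) : Integrable (logTerm b) (invMeasure b) := by
  rw [← lintegral_ofReal_ne_top_iff_integrable (measurable_logTerm b).aestronglyMeasurable
    (ae_nonneg_logTerm hb), lintegral_logTerm hb]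
  exact ENNReal.ofReal_ne_top

theorem integral_logTerm {b : ℕ} (hb : 2 ≤ b) :
    ∫ x, logTerm b x ∂invMeasure b = Real.log b * khinchineExponent b := by
  rw [integral_eq_lintegral_of_nonneg_ae (ae_nonneg_logTerm hb)
    (measurable_logTerm b).aestronglyMeasurable, lintegral_logTerm hb,
    ENNReal.toReal_ofReal]
  rw [← mean_eq_log_mul_khinchineExponent hb]
  exact add_nonneg (coeffMean_nonneg hb) (exponentMean_nonneg hb)

/-! ### From the remainder map to continued logarithms -/

/-- Both sides are the junk value `0` when the process terminates at index `n`. -/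
theorem remainder_succ {b : ℕ} (hb : b ≠ 0) (α : ℝ) (n : ℕ) :
    remainder b α (n + 1) = (step b (remainder b α n)⁻¹)⁻¹ := by
  have hB : (b : ℝ) ^ exponentOf b (remainder b α n) ≠ 0 :=
    zpow_ne_zero _ (by exact_mod_cast hb)
  rw [remainder, step, inv_inv, Int.fract, ← coeffOf, div_sub' hB, inv_div, mul_comm]

theorem remainder_succ_eq_inv_iterate {b : ℕ} (hb : 2 ≤ b) {α : ℝ} (hα : α ∈ Ioo (1 : ℝ) 2)
    (n : ℕ) : remainder b α (n + 1) = ((step b)^[n] (α - 1))⁻¹ := by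
  induction n with
  | zero =>
    have h : α⁻¹ = branch b 0 1 (α - 1) := by simp [branch]
    rw [remainder_succ (by omega), remainder, h, step_branch le_rfl (by omega)
      ⟨by linarith [hα.1], by linarith [hα.2]⟩]
    rfl
  | succ n ih => rw [remainder_succ (by omega), ih, inv_inv, Function.iterate_succ_apply']

/-- A process that terminates at index `n` has the junk value `remainder b α (n + 1) = 0`. -/
theorem isInfinite_of_remainder_ne_zero {b : ℕ} {α : ℝ}
    (h : ∀ n, remainder b α (n + 1) ≠ 0) : IsInfinite b α := by
  intro n hn
  refine h n ?_
  rw [remainder, ← coeff, ← exponent, ← term, sub_eq_zero.2 hn, div_zero]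

theorem exp_logTerm {b : ℕ} (hb : 2 ≤ b) {x : ℝ} (hx : x ∈ Ioo (0 : ℝ) 1) :
    Real.exp (logTerm b x) = (coeffOf b x⁻¹ : ℝ) * (b : ℝ) ^ exponentOf b x⁻¹ := by
  have hb' : (0 : ℝ) < b := by exact_mod_cast (show 0 < b by omega)
  refine Real.exp_log (mul_pos ?_ (zpow_pos hb' _))
  obtain ⟨a, c, hc, hcb, h⟩ := exists_eq_branch_step hb hx
  rw [h, coeffOf_inv_branch hc hcb (step_mem_Ico b x)]
  exact_mod_cast hc

theorem prod_term_eq_exp_birkhoffSum {b : ℕ} (hb : 2 ≤ b) {α : ℝ} (hα : α ∈ Ioo (1 : ℝ) 2)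
    (h : ∀ n, (step b)^[n] (α - 1) ∈ Ioo (0 : ℝ) 1) (N : ℕ) :
    ∏ n ∈ Finset.Icc 1 N, term b α n =
      Real.exp (birkhoffSum (step b) (logTerm b) N (α - 1)) := by
  induction N with
  | zero => simp
  | succ N ih =>
    rw [Finset.prod_Icc_succ_top (by omega), ih, birkhoffSum_succ, Real.exp_add,
      exp_logTerm hb (h N), term, coeff, exponent, remainder_succ_eq_inv_iterate hb hα]

theorem ae_restrict_Ioo_one_two {P : ℝ → Prop}
    (h : ∀ᵐ x ∂volume.restrict (Ioo (0 : ℝ) 1), P x) :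
    ∀ᵐ α ∂volume.restrict (Ioo (1 : ℝ) 2), P (α - 1) := by
  have h1 := ((measurePreserving_sub_right (volume : Measure ℝ) 1).restrict_preimage
    (measurableSet_Ioo (a := (0 : ℝ)) (b := 1))).quasiMeasurePreserving.ae h
  have h2 : (fun α : ℝ => α - 1) ⁻¹' Ioo 0 1 = Ioo 1 2 := by
    rw [preimage_sub_const_Ioo]
    norm_num
  rwa [h2] at h1

end ContinuedLogarithm

theorem mainTheorem6 (b : ℕ) (hb : 2 ≤ b) :
    ∀ᵐ α : ℝ ∂(MeasureTheory.volume.restrict (Set.Ioo (1 : ℝ) 2)),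
      ContinuedLogarithm.IsInfinite b α ∧
      Filter.Tendsto
        (fun N : ℕ =>
          (∏ n ∈ Finset.Icc 1 N, ContinuedLogarithm.term b α n) ^ (1 / (N : ℝ)))
        Filter.atTop
        (nhds ((b : ℝ) ^ ContinuedLogarithm.khinchineExponent b)) := by
  open ContinuedLogarithm in
  have hprob := isProbabilityMeasure_invMeasure hb
  have herg := (absolutelyContinuous_invMeasure hb).ae_le
    (ae_tendsto_birkhoffSum_div (ergodic_step hb) (measurable_logTerm b) (integrable_logTerm hb))
  filter_upwards [ae_restrict_mem measurableSet_Ioo,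
    ae_restrict_Ioo_one_two (ae_forall_iterate_step_mem hb),
    ae_restrict_Ioo_one_two herg] with α hα hmem hlim
  refine ⟨isInfinite_of_remainder_ne_zero fun n => ?_, ?_⟩
  · rw [remainder_succ_eq_inv_iterate hb hα]
    exact inv_ne_zero (hmem n).1.ne'
  · have hb' : (0 : ℝ) < b := by exact_mod_cast (show 0 < b by omega)
    rw [integral_logTerm hb] at hlim
    rw [Real.rpow_def_of_pos hb']
    refine ((Real.continuous_exp.tendsto _).comp hlim).congr fun N => ?_
    rw [prod_term_eq_exp_birkhoffSum hb hα hmem, ← Real.exp_mul, mul_one_div]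
    rfl
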